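/- Let $K$ be a field and let $G$ be a finite simple graph on the vertex set $[d]=\{1,\dots,d\}$ with edge set $E(G)=\{e_1,\dots,e_n\}$. For $M\subseteq E(G)$ let $\rho(M)=\sum_{e_j\in M}\mathbf e_j\in\mathbb R^n$. A matching of $G$ is a set of pairwise non-adjacent edges, and it is perfect if it covers every vertex. Let $\mathcal M_G$ (resp. $\mathcal P_G$) be the convex hull of the vectors $\rho(M)$ where $M$ runs over all matchings (resp. all perfect matchings) of $G$. For a lattice polytope $\mathcal P\subset\mathbb R^n_{\ge 0}$ (possibly empty), the toric ideal $I_{\mathcal P}$ is the kernel of the $K$-algebra homomorphism $K[x_{\mathbf a}:\mathbf a\in\mathcal P\cap\mathbb Z^n_{\ge 0}]\to K[t_1,\dots,t_n,s]$, $x_{\mathbf a}\mapsto t_1^{a_1}\cdots t_n^{a_n}s$. It is homogeneous for $\deg x_{\mathbf a}=1$. For a homogeneous ideal $I$, let $\omega(I)$ denote the maximal degree of the minimal (homogeneous) generators of $I$, with the convention $\omega(\{0\})=2$. Then: (a) $\omega(I_{\mathcal P_G})\le\omega(I_{\mathcal M_G})$. (b) Let $G'$ be the graph on $[2d]$ obtained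 by taking two disjoint copies of $G$ and adding an edge between each vertex and its copy. Then $G'$ has $2n+d$ edges, and $\omega(I_{\mathcal M_G})\le\omega(I_{\mathcal P_{G'}})$. In particular, there exists a graph $G'$ on $[2d]$ with $2n+d$ edges such that $\omega(I_{\mathcal M_G})\le\omega(I_{\mathcal P_{G'}})$. -/

import Mathlib

noncomputable section

namespace MatchingToric

open MvPolynomial

/-- The nonnegative lattice points of a set `P` in the real vector space `ι → ℝ`. -/
def latticePoints {ι : Type*} (P : Set (ι → ℝ)) : Set (ι →₀ ℕ) :=
  {a | (fun i => (a i : ℝ)) ∈ P}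

/-- The `K`-algebra homomorphism from the polynomial ring with one variable `x_a` for each
nonnegative lattice point `a` of `P`, sending `x_a` to `t^a * s`. The variable `s` is `X none`
and the variable `t_i` is `X (some i)`. -/
def toricMap {ι : Type*} (K : Type*) [Field K] (P : Set (ι → ℝ)) :
    MvPolynomial (latticePoints P) K →ₐ[K] MvPolynomial (Option ι) K :=
  aeval fun a => (a.1.prod fun i m => X (some i) ^ m) * X none

/-- The toric ideal of `P` over the field `K`. -/
def toricIdeal {ι : Type*} (K : Type*) [Field K] (P : Set (ι → ℝ)) :
    Ideal (MvPolynomial (latticePoints P) K) :=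
  RingHom.ker (toricMap K P)

/-- `S` is a set of homogeneous generators of `I`. -/
def IsHomogeneousGenerators {σ K : Type*} [Field K] (I : Ideal (MvPolynomial σ K))
    (S : Set (MvPolynomial σ K)) : Prop :=
  (∀ f ∈ S, ∃ k : ℕ, f.IsHomogeneous k) ∧ Ideal.span S = I

/-- `f` is a minimal generator of the homogeneous ideal `I`: it belongs to some set of
homogeneous generators of `I` that is minimal under inclusion. -/
def IsMinimalGenerator {σ K : Type*} [Field K] (I : Ideal (MvPolynomial σ K))
    (f : MvPolynomial σ K) : Prop :=
  ∃ S : Set (MvPolynomial σ K), Minimal (IsHomogeneousGenerators I) S ∧ f ∈ S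

open Classical in
/-- The maximal degree of the minimal generators of a homogeneous ideal,
with the convention that it is `2` for the zero ideal. -/
def omega {σ K : Type*} [Field K] (I : Ideal (MvPolynomial σ K)) : ℕ :=
  if I = ⊥ then 2 else sSup {k | ∃ f, IsMinimalGenerator I f ∧ f.totalDegree = k}

section Graph

variable {V : Type*}

/-- A set of edges of `G` is a matching if its edges are pairwise non-adjacent, that is,
no two distinct ones share a vertex. -/
def IsMatching (G : SimpleGraph V) (M : Set G.edgeSet) : Prop :=
  ∀ e ∈ M, ∀ e' ∈ M, e ≠ e' → ∀ v : V, ¬(v ∈ e.1 ∧ v ∈ e'.1)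

/-- A matching is perfect if it covers every vertex. -/
def IsPerfectMatching (G : SimpleGraph V) (M : Set G.edgeSet) : Prop :=
  IsMatching G M ∧ ∀ v : V, ∃ e ∈ M, v ∈ e.1

/-- The `(0,1)`-vector of a set of edges. -/
def rho (G : SimpleGraph V) (M : Set G.edgeSet) : G.edgeSet → ℝ :=
  M.indicator 1

/-- The (full) matching polytope. -/
def matchingPolytope (G : SimpleGraph V) : Set (G.edgeSet → ℝ) :=
  convexHull ℝ {x | ∃ M, IsMatching G M ∧ x = rho G M}

/-- The perfect matching polytope. -/
def perfectMatchingPolytope (G : SimpleGraph V) : Set (G.edgeSet → ℝ) :=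
  convexHull ℝ {x | ∃ M, IsPerfectMatching G M ∧ x = rho G M}

end Graph

/-- Two disjoint copies of a graph on `d` vertices, with an edge added between each vertex and
its copy. The vertices `0, …, d - 1` form the first copy and `d, …, 2 * d - 1` the second one;
the copy of `v` is `v + d`. -/
def doubleGraph {d : ℕ} (G : SimpleGraph (Fin d)) : SimpleGraph (Fin (2 * d)) :=
  ((⊤ : SimpleGraph (Fin 2)).boxProd G).map finProdFinEquiv

end MatchingToric

end

/-!
Let `A` and `B` be polynomial rings with homogeneous ideals `I` and `J`, and let `j : A → B` and
`r : B → A` be homomorphisms with `r ∘ j = id`, `j I ⊆ J` and `r J ⊆ I`, where `r` preserves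
degrees. Then `r J = I`, so the images under `r` of the generators of `J` of degree at most `ω(J)`
generate `I`. If `J` is a toric ideal it contains no linear forms, so `ω(J) ≥ 2`, which takes care
of `I = 0`; hence `ω(I) ≤ ω(J)`.

A toric ideal is spanned by the binomials `x ^ c - x ^ c'` for which `c` and `c'` have equal sums of
lattice points and equal degrees, and affine maps preserve equality of such sums. This yields two
kinds of retractions. If `P` is the face of `Q` on which some nonnegative affine functions vanish,
then `r` kills the variables outside the face: the two monomials of a binomial are both supported
on the face or both not. If affine maps `F` and `R` send the lattice points of `P` to those of `Q`
and back, with `R ∘ F = id` on those of `P`, then `j` and `r` rename the variables along `F` and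
`R`.

The lattice points of a `0/1`-polytope are its given vertices, because `0/1`-vectors are extreme
points of the cube. The perfect matching polytope is the face of the matching polytope where all
the degree inequalities `∑ x_e ≤ 1` are equalities, which gives (a). For (b), send a matching `M` to
the perfect matching of the prism made of two copies of `M` and the rungs at the uncovered
vertices; the coefficient at a rung is the slack of the degree inequality, so this map is affine,
and restriction to one copy of `G` inverts it.
-/

namespace MatchingToric

open MvPolynomial

section Omega

attribute [local instance] MvPolynomial.gradedAlgebra

variable {σ τ K : Type*} [Field K]

theorem homogeneousComponent_mul_eq_zero {f : MvPolynomial σ K} {j k : ℕ}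
    (hf : f.IsHomogeneous k) (hjk : j < k) (a : MvPolynomial σ K) :
    homogeneousComponent j (a * f) = 0 := by
  rw [← decomposition.decompose'_apply]
  exact DirectSum.coe_decompose_mul_of_right_mem_of_not_le (homogeneousSubmodule σ K) hf hjk.not_ge

theorem mem_span_diff_singleton {S : Set (MvPolynomial σ K)}
    (hS : ∀ f ∈ S, ∃ k : ℕ, f.IsHomogeneous k) {f g : MvPolynomial σ K} {j k : ℕ}
    (hf : f.IsHomogeneous k) (hg : g.IsHomogeneous j) (hjk : j < k) (hgS : g ∈ Ideal.span S) :
    g ∈ Ideal.span (S \ {f}) := by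
  have hinsert : g ∈ Ideal.span (insert f (S \ {f})) :=
    Ideal.span_mono (by rw [Set.insert_sdiff_singleton]; exact Set.subset_insert f S) hgS
  obtain ⟨a, z, hz, rfl⟩ := Ideal.mem_span_insert.mp hinsert
  have hhom : (Ideal.span (S \ {f})).IsHomogeneous (homogeneousSubmodule σ K) :=
    Ideal.homogeneous_span _ _ fun x hx => hS x hx.1
  have hcomp : homogeneousComponent j z = a * f + z := by
    rw [← homogeneousComponent_eq_self hg, map_add, homogeneousComponent_mul_eq_zero hf hjk,
      zero_add]
  exact hcomp ▸ homogeneousComponent_mem_of_mem hhom hz j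

theorem ne_zero_of_minimal_isHomogeneousGenerators {I : Ideal (MvPolynomial σ K)}
    {S : Set (MvPolynomial σ K)} (hS : Minimal (IsHomogeneousGenerators I) S)
    {f : MvPolynomial σ K} (hf : f ∈ S) : f ≠ 0 := by
  rintro rfl
  have hgen : IsHomogeneousGenerators I (S \ {0}) :=
    ⟨fun g hg => hS.1.1 g hg.1, by rw [Ideal.span_sdiff_singleton_zero, hS.1.2]⟩
  exact (hS.2 hgen Set.sdiff_subset hf).2 rfl

theorem totalDegree_le_of_isMinimalGenerator {I : Ideal (MvPolynomial σ K)} {N : ℕ}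
    (hN : I ≤ Ideal.span {f | f ∈ I ∧ ∃ k ≤ N, f.IsHomogeneous k})
    {f : MvPolynomial σ K} (hf : IsMinimalGenerator I f) : f.totalDegree ≤ N := by
  obtain ⟨S, hS, hfS⟩ := hf
  obtain ⟨k, hk⟩ := hS.1.1 f hfS
  rw [hk.totalDegree (ne_zero_of_minimal_isHomogeneousGenerators hS hfS)]
  by_contra! hNk
  have hle : I ≤ Ideal.span (S \ {f}) := by
    refine hN.trans (Ideal.span_le.mpr ?_)
    rintro g ⟨hgI, j, hjN, hg⟩
    exact mem_span_diff_singleton hS.1.1 hk hg (hjN.trans_lt hNk) (hS.1.2.symm ▸ hgI)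
  have hgen : IsHomogeneousGenerators I (S \ {f}) :=
    ⟨fun g hg => hS.1.1 g hg.1, ((Ideal.span_mono Set.sdiff_subset).trans hS.1.2.le).antisymm hle⟩
  exact (hS.2 hgen Set.sdiff_subset hfS).2 rfl

theorem omega_bot : omega (⊥ : Ideal (MvPolynomial σ K)) = 2 := if_pos rfl

theorem omega_le {I : Ideal (MvPolynomial σ K)} (hI : I ≠ ⊥) {N : ℕ}
    (hN : I ≤ Ideal.span {f | f ∈ I ∧ ∃ k ≤ N, f.IsHomogeneous k}) : omega I ≤ N := by
  rw [omega, if_neg hI]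
  refine csSup_le' ?_
  rintro _ ⟨f, hf, rfl⟩
  exact totalDegree_le_of_isMinimalGenerator hN hf

theorem exists_finset_isHomogeneousGenerators [Finite σ] {I : Ideal (MvPolynomial σ K)}
    (hI : I.IsHomogeneous (homogeneousSubmodule σ K)) :
    ∃ T : Finset (MvPolynomial σ K), IsHomogeneousGenerators I (T : Set (MvPolynomial σ K)) := by
  obtain ⟨S, rfl⟩ := (Ideal.IsHomogeneous.iff_exists _ _).mp hI
  obtain ⟨T, hTS, hT⟩ := (Submodule.fg_span_iff_fg_span_finset_subset _).mp
    (IsNoetherian.noetherian (Ideal.span ((↑) '' S : Set (MvPolynomial σ K))))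
  refine ⟨T, fun f hf => ?_, hT.symm⟩
  obtain ⟨x, -, rfl⟩ := hTS hf
  exact x.2

theorem exists_finset_minimal_isHomogeneousGenerators [Finite σ] {I : Ideal (MvPolynomial σ K)}
    (hI : I.IsHomogeneous (homogeneousSubmodule σ K)) :
    ∃ T : Finset (MvPolynomial σ K),
      Minimal (IsHomogeneousGenerators I) (T : Set (MvPolynomial σ K)) := by
  obtain ⟨T, hT⟩ := exists_minimal_of_wellFoundedLT
    (fun T : Finset (MvPolynomial σ K) => IsHomogeneousGenerators I (T : Set (MvPolynomial σ K)))
    (exists_finset_isHomogeneousGenerators hI)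
  refine ⟨T, hT.1, fun S hS hST => ?_⟩
  lift S to Finset (MvPolynomial σ K) using T.finite_toSet.subset hST
  exact_mod_cast hT.2 hS (by exact_mod_cast hST)

theorem le_span_isHomogeneous_le_omega [Finite σ] {I : Ideal (MvPolynomial σ K)}
    (hI : I.IsHomogeneous (homogeneousSubmodule σ K)) :
    I ≤ Ideal.span {f | f ∈ I ∧ ∃ k ≤ omega I, f.IsHomogeneous k} := by
  rcases eq_or_ne I ⊥ with rfl | hbot
  · exact bot_le
  obtain ⟨T, hT⟩ := exists_finset_minimal_isHomogeneousGenerators hI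
  have hspan : Ideal.span (T : Set (MvPolynomial σ K)) = I := hT.1.2
  have hmem : ∀ f ∈ T, f ∈ I := fun f hf => hspan ▸ Ideal.subset_span hf
  have hhom : ∀ f ∈ T, f.IsHomogeneous f.totalDegree := fun f hf => by
    obtain ⟨k, hk⟩ := hT.1.1 f hf
    rwa [hk.totalDegree (ne_zero_of_minimal_isHomogeneousGenerators hT hf)]
  have hbdd : BddAbove {k | ∃ f, IsMinimalGenerator I f ∧ f.totalDegree = k} := by
    refine ⟨T.sup totalDegree, ?_⟩
    rintro _ ⟨f, hf, rfl⟩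
    exact totalDegree_le_of_isMinimalGenerator (hspan.symm.le.trans <|
      Ideal.span_mono fun g hg => ⟨hmem g hg, _, Finset.le_sup hg, hhom g hg⟩) hf
  refine hspan.symm.le.trans <| Ideal.span_mono fun f hf => ⟨hmem f hf, _, ?_, hhom f hf⟩
  rw [omega, if_neg hbot]
  exact le_csSup hbdd ⟨f, ⟨_, hT, hf⟩, rfl⟩

theorem two_le_omega [Finite σ] {I : Ideal (MvPolynomial σ K)}
    (hI : I.IsHomogeneous (homogeneousSubmodule σ K))
    (hlow : ∀ f ∈ I, ∀ k ≤ 1, homogeneousComponent k f = 0) : 2 ≤ omega I := by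
  rcases eq_or_ne I ⊥ with rfl | hbot
  · exact omega_bot.ge
  by_contra! hlt
  refine hbot (le_bot_iff.mp ((le_span_isHomogeneous_le_omega hI).trans (Ideal.span_le.mpr ?_)))
  rintro f ⟨hf, k, hk, hfk⟩
  rw [← homogeneousComponent_eq_self hfk, hlow f hf k (by omega)]
  exact zero_mem _

theorem omega_map_le [Finite τ] {J : Ideal (MvPolynomial τ K)}
    (hJ : J.IsHomogeneous (homogeneousSubmodule τ K)) (htwo : 2 ≤ omega J)
    (r : MvPolynomial τ K →ₐ[K] MvPolynomial σ K)
    (hr : ∀ (f : MvPolynomial τ K) (k : ℕ), f.IsHomogeneous k → (r f).IsHomogeneous k) :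
    omega (J.map r) ≤ omega J := by
  rcases eq_or_ne (J.map r) ⊥ with hbot | hbot
  · rwa [hbot, omega_bot]
  refine omega_le hbot ((Ideal.map_mono (le_span_isHomogeneous_le_omega hJ)).trans ?_)
  rw [Ideal.map_span]
  refine Ideal.span_mono ?_
  rintro _ ⟨f, ⟨hf, k, hk, hfk⟩, rfl⟩
  exact ⟨Ideal.mem_map_of_mem r hf, k, hk, hr f k hfk⟩

end Omega

section ToricIdeal

attribute [local instance] MvPolynomial.gradedAlgebra

variable {ι K : Type*} [Field K]

/-- The exponent of the image `t ^ (∑ a, c a • a) * s ^ (∑ a, c a)` of the monomial `x ^ c` under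
the toric map; as in `toricMap`, the index `none` belongs to the variable `s`. -/
noncomputable def toricExponent (A : Set (ι →₀ ℕ)) : (A →₀ ℕ) →ₗ[ℕ] (Option ι →₀ ℕ) :=
  Finsupp.linearCombination ℕ fun a : A => a.1.optionElim 1

theorem toricExponent_apply_none (A : Set (ι →₀ ℕ)) (c : A →₀ ℕ) :
    toricExponent A c none = c.degree := by
  simp [toricExponent, Finsupp.linearCombination_apply, Finsupp.degree_apply, Finsupp.sum]

theorem toricExponent_apply_some (A : Set (ι →₀ ℕ)) (c : A →₀ ℕ) (i : ι) :
    toricExponent A c (some i) = c.sum fun a m => m * a.1 i := by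
  simp [toricExponent, Finsupp.linearCombination_apply, Finsupp.sum_apply]

theorem degree_eq_of_toricExponent_eq {A : Set (ι →₀ ℕ)} {c c' : A →₀ ℕ}
    (h : toricExponent A c = toricExponent A c') : c.degree = c'.degree := by
  rw [← toricExponent_apply_none, h, toricExponent_apply_none]

theorem eq_of_toricExponent_eq_of_degree_le_one {A : Set (ι →₀ ℕ)} {c c' : A →₀ ℕ}
    (h : toricExponent A c = toricExponent A c') (hc : c.degree ≤ 1) : c = c' := by
  have hdeg := degree_eq_of_toricExponent_eq h
  obtain h0 | h1 := Nat.le_one_iff_eq_zero_or_eq_one.mp hc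
  · rw [(Finsupp.degree_eq_zero_iff c).mp h0,
      (Finsupp.degree_eq_zero_iff c').mp (hdeg.symm.trans h0)]
  · obtain ⟨a, rfl⟩ := (Finsupp.sum_eq_one_iff _).mp h1
    obtain ⟨b, rfl⟩ := (Finsupp.sum_eq_one_iff _).mp (hdeg.symm.trans h1)
    have hab : a = b := by
      ext i
      simpa [toricExponent_apply_some] using DFunLike.congr_fun h (some i)
    rw [hab]

theorem toricMap_monomial (P : Set (ι → ℝ)) (c : latticePoints P →₀ ℕ) (k : K) :
    toricMap K P (monomial c k) = monomial (toricExponent _ c) k := by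
  have hX : ∀ a : latticePoints P,
      ((a.1.prod fun i m => X (some i) ^ m) * X none : MvPolynomial (Option ι) K) =
        monomial (a.1.optionElim 1) 1 := by
    intro a
    rw [monomial_eq, Finsupp.prod_option_index _ _ (by simp) (by simp [pow_add])]
    simp [mul_comm]
  rw [toricMap, aeval_monomial, toricExponent, Finsupp.linearCombination_apply,
    monomial_finsupp_sum_index]
  simp only [hX, monomial_pow, one_pow]
  rfl

/-- The binomials `x ^ c - x ^ c'` whose two terms have the same image under the toric map. -/
def toricBinomials (K : Type*) [Field K] (P : Set (ι → ℝ)) :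
    Set (MvPolynomial (latticePoints P) K) :=
  {f | ∃ c c', toricExponent _ c = toricExponent _ c' ∧ f = monomial c 1 - monomial c' 1}

theorem toricBinomials_subset_toricIdeal (P : Set (ι → ℝ)) :
    toricBinomials K P ⊆ toricIdeal K P := by
  rintro _ ⟨c, c', h, rfl⟩
  rw [SetLike.mem_coe, toricIdeal, RingHom.mem_ker, map_sub, toricMap_monomial, toricMap_monomial,
    h, sub_self]

theorem mem_span_toricBinomials {P : Set (ι → ℝ)} {f : MvPolynomial (latticePoints P) K}
    (hf : f ∈ toricIdeal K P) : f ∈ Submodule.span K (toricBinomials K P) := by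
  -- Replace every monomial of `f` by a chosen one with the same image: the difference is a
  -- combination of binomials, and the result depends on the image of `f` only, which is zero.
  let g : (Option ι →₀ ℕ) → (latticePoints P →₀ ℕ) := Function.invFun (toricExponent _)
  have hg : ∀ c, toricExponent _ (g (toricExponent _ c)) = toricExponent (latticePoints P) c :=
    fun c => Function.invFun_eq ⟨c, rfl⟩
  have hsub : ∀ p : MvPolynomial (latticePoints P) K,
      p - AddMonoidAlgebra.mapDomain g (toricMap K P p) ∈
        Submodule.span K (toricBinomials K P) := by
    intro p
    induction p using MvPolynomial.induction_on' with
    | add p q hp hq =>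
      rw [map_add, AddMonoidAlgebra.mapDomain_add, add_sub_add_comm]
      exact add_mem hp hq
    | monomial c k =>
      have hmap : AddMonoidAlgebra.mapDomain g (toricMap K P (monomial c k)) =
          monomial (g (toricExponent _ c)) k := by
        rw [toricMap_monomial]
        exact AddMonoidAlgebra.mapDomain_single
      have hsmul : ∀ c : latticePoints P →₀ ℕ, monomial c k = k • monomial c (1 : K) :=
        fun c => by rw [smul_monomial, smul_eq_mul, mul_one]
      rw [hmap, hsmul c, hsmul, ← smul_sub]
      exact Submodule.smul_mem _ _ (Submodule.subset_span ⟨_, _, (hg c).symm, rfl⟩)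
  have hzero : toricMap K P f = 0 := hf
  simpa only [hzero, AddMonoidAlgebra.mapDomain_zero, sub_zero] using hsub f

theorem toricIdeal_eq_span (P : Set (ι → ℝ)) :
    toricIdeal K P = Ideal.span (toricBinomials K P) :=
  le_antisymm (fun _ hf => Submodule.span_le_restrictScalars K _ _ (mem_span_toricBinomials hf))
    (Ideal.span_le.mpr (toricBinomials_subset_toricIdeal P))

theorem toricIdeal_isHomogeneous (P : Set (ι → ℝ)) :
    (toricIdeal K P).IsHomogeneous (homogeneousSubmodule (latticePoints P) K) := by
  rw [toricIdeal_eq_span]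
  refine Ideal.homogeneous_span _ _ ?_
  rintro _ ⟨c, c', h, rfl⟩
  exact ⟨c.degree, (isHomogeneous_monomial 1 rfl).sub
    (isHomogeneous_monomial 1 (degree_eq_of_toricExponent_eq h).symm)⟩

theorem homogeneousComponent_eq_zero_of_mem_toricIdeal {P : Set (ι → ℝ)}
    {f : MvPolynomial (latticePoints P) K} (hf : f ∈ toricIdeal K P) {k : ℕ} (hk : k ≤ 1) :
    homogeneousComponent k f = 0 := by
  suffices hle : Submodule.span K (toricBinomials K P) ≤ LinearMap.ker (homogeneousComponent k) from
    hle (mem_span_toricBinomials hf)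
  refine Submodule.span_le.mpr ?_
  rintro _ ⟨c, c', h, rfl⟩
  rw [SetLike.mem_coe, LinearMap.mem_ker, map_sub,
    homogeneousComponent_of_mem (isHomogeneous_monomial 1 rfl),
    homogeneousComponent_of_mem
      (isHomogeneous_monomial 1 (degree_eq_of_toricExponent_eq h).symm)]
  split_ifs with hck
  · rw [eq_of_toricExponent_eq_of_degree_le_one h (hck ▸ hk), sub_self]
  · exact sub_zero 0

theorem two_le_omega_toricIdeal (P : Set (ι → ℝ)) [Finite (latticePoints P)] :
    2 ≤ omega (toricIdeal K P) :=
  two_le_omega (toricIdeal_isHomogeneous P) fun _ hf _ hk =>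
    homogeneousComponent_eq_zero_of_mem_toricIdeal hf hk

end ToricIdeal

section Retract

variable {ι κ E K : Type*} [AddCommGroup E] [Module ℝ E] [Field K]

/-- A nonnegative lattice point, viewed as a real vector. -/
def realPoint (a : ι →₀ ℕ) : ι → ℝ := fun i => a i

/-- The nonnegative lattice points of `P`, viewed as real vectors. -/
def latticeVectors (P : Set (ι → ℝ)) : Set (ι → ℝ) := realPoint '' latticePoints P

theorem realPoint_injective : Function.Injective (realPoint (ι := ι)) := fun _ _ h =>
  Finsupp.ext fun i => Nat.cast_injective (congrFun h i)

theorem realPoint_mem_latticeVectors {P : Set (ι → ℝ)} (a : latticePoints P) :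
    realPoint a.1 ∈ latticeVectors P := Set.mem_image_of_mem realPoint a.2

theorem finite_latticePoints {P : Set (ι → ℝ)} (hP : (latticeVectors P).Finite) :
    Finite (latticePoints P) :=
  (Set.Finite.of_finite_image hP realPoint_injective.injOn).to_subtype

theorem sum_smul_realPoint (A : Set (ι →₀ ℕ)) (c : A →₀ ℕ) :
    (c.sum fun a m => m • realPoint a.1) = fun i => (toricExponent A c (some i) : ℝ) := by
  ext i
  simp [toricExponent_apply_some, Finsupp.sum, realPoint]

theorem sum_smul_affineMap (A : Set (ι →₀ ℕ)) (c : A →₀ ℕ) (f : (ι → ℝ) →ᵃ[ℝ] E) :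
    (c.sum fun a m => m • f (realPoint a.1)) =
      f.linear (fun i => (toricExponent A c (some i) : ℝ)) + toricExponent A c none • f 0 := by
  rw [← sum_smul_realPoint, toricExponent_apply_none, Finsupp.degree_apply, map_finsuppSum,
    Finset.sum_smul, Finsupp.sum, Finsupp.sum, ← Finset.sum_add_distrib]
  refine Finset.sum_congr rfl fun a _ => ?_
  rw [congrFun f.decomp, Pi.add_apply, smul_add, map_nsmul]

theorem sum_smul_affineMap_congr {A : Set (ι →₀ ℕ)} {c c' : A →₀ ℕ}
    (h : toricExponent A c = toricExponent A c') (f : (ι → ℝ) →ᵃ[ℝ] E) :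
    (c.sum fun a m => m • f (realPoint a.1)) = c'.sum fun a m => m • f (realPoint a.1) := by
  rw [sum_smul_affineMap, sum_smul_affineMap, h]

theorem toricExponent_mapDomain_congr {A : Set (ι →₀ ℕ)} {B : Set (κ →₀ ℕ)} {q : A → B}
    {F : (ι → ℝ) →ᵃ[ℝ] (κ → ℝ)} (hq : ∀ a, realPoint (q a).1 = F (realPoint a.1))
    {c c' : A →₀ ℕ} (h : toricExponent A c = toricExponent A c') :
    toricExponent B (c.mapDomain q) = toricExponent B (c'.mapDomain q) := by
  have hsum (c : A →₀ ℕ) : (fun j => (toricExponent B (c.mapDomain q) (some j) : ℝ)) =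
      c.sum fun a m => m • F (realPoint a.1) := by
    simp only [← sum_smul_realPoint, ← hq]
    exact Finsupp.sum_mapDomain_index (fun _ => zero_smul ℕ _) (fun _ _ _ => add_smul _ _ _)
  ext (_ | j)
  · rw [toricExponent_apply_none, toricExponent_apply_none, Finsupp.degree_mapDomain,
      Finsupp.degree_mapDomain, degree_eq_of_toricExponent_eq h]
  · have hj := congrFun (sum_smul_affineMap_congr h F) j
    rw [← hsum, ← hsum] at hj
    exact Nat.cast_injective (R := ℝ) hj

theorem toricIdeal_le_comap_rename {P : Set (ι → ℝ)} {Q : Set (κ → ℝ)}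
    {q : latticePoints P → latticePoints Q} {F : (ι → ℝ) →ᵃ[ℝ] (κ → ℝ)}
    (hq : ∀ a, realPoint (q a).1 = F (realPoint a.1)) :
    toricIdeal K P ≤ (toricIdeal K Q).comap (rename q) := by
  rw [toricIdeal_eq_span, Ideal.span_le]
  rintro _ ⟨c, c', h, rfl⟩
  refine toricBinomials_subset_toricIdeal Q
    ⟨c.mapDomain q, c'.mapDomain q, toricExponent_mapDomain_congr hq h, ?_⟩
  rw [map_sub, rename_monomial, rename_monomial]

theorem omega_toricIdeal_le_of_retract {P : Set (ι → ℝ)} {Q : Set (κ → ℝ)}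
    [Finite (latticePoints Q)]
    {j : MvPolynomial (latticePoints P) K →ₐ[K] MvPolynomial (latticePoints Q) K}
    {r : MvPolynomial (latticePoints Q) K →ₐ[K] MvPolynomial (latticePoints P) K}
    (hrj : r.comp j = AlgHom.id K _)
    (hr_hom : ∀ (f : MvPolynomial (latticePoints Q) K) (k : ℕ),
      f.IsHomogeneous k → (r f).IsHomogeneous k)
    (hj : toricIdeal K P ≤ (toricIdeal K Q).comap j)
    (hr : toricIdeal K Q ≤ (toricIdeal K P).comap r) :
    omega (toricIdeal K P) ≤ omega (toricIdeal K Q) := by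
  have hmap : (toricIdeal K Q).map r = toricIdeal K P := by
    refine le_antisymm (Ideal.map_le_iff_le_comap.mpr hr) fun f hf => ?_
    rw [← AlgHom.id_apply (R := K) f, ← hrj]
    exact Ideal.mem_map_of_mem r (hj hf)
  rw [← hmap]
  exact omega_map_le (toricIdeal_isHomogeneous Q) (two_le_omega_toricIdeal Q) r hr_hom

theorem exists_realPoint_eq_of_mapsTo {P : Set (ι → ℝ)} {Q : Set (κ → ℝ)}
    {F : (ι → ℝ) → (κ → ℝ)} (hF : Set.MapsTo F (latticeVectors P) (latticeVectors Q)) :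
    ∃ q : latticePoints P → latticePoints Q, ∀ a, realPoint (q a).1 = F (realPoint a.1) := by
  choose q hq hqF using fun a : latticePoints P => hF (realPoint_mem_latticeVectors a)
  exact ⟨fun a => ⟨q a, hq a⟩, hqF⟩

theorem omega_toricIdeal_le_of_affine_retract {P : Set (ι → ℝ)} {Q : Set (κ → ℝ)}
    (hfin : (latticeVectors Q).Finite)
    {F : (ι → ℝ) →ᵃ[ℝ] (κ → ℝ)} {R : (κ → ℝ) →ᵃ[ℝ] (ι → ℝ)}
    (hF : Set.MapsTo F (latticeVectors P) (latticeVectors Q))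
    (hR : Set.MapsTo R (latticeVectors Q) (latticeVectors P))
    (hRF : Set.LeftInvOn R F (latticeVectors P)) :
    omega (toricIdeal K P) ≤ omega (toricIdeal K Q) := by
  have := finite_latticePoints hfin
  obtain ⟨q, hq⟩ := exists_realPoint_eq_of_mapsTo hF
  obtain ⟨r, hr⟩ := exists_realPoint_eq_of_mapsTo hR
  have hrq : r ∘ q = id := by
    ext1 a
    refine Subtype.ext (realPoint_injective ?_)
    rw [Function.comp_apply, hr, hq, hRF (realPoint_mem_latticeVectors a), id]
  refine omega_toricIdeal_le_of_retract (j := rename q) (r := rename r) ?_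
    (fun _ _ hf => hf.rename_isHomogeneous) (toricIdeal_le_comap_rename hq)
    (toricIdeal_le_comap_rename hr)
  ext1 a
  rw [AlgHom.comp_apply, rename_X, rename_X, ← Function.comp_apply (f := r), hrq, id,
    AlgHom.id_apply]

end Retract

section Face

variable {ι σ τ V K : Type*} [Field K]

theorem isHomogeneous_killCompl {i : σ → τ} (hi : Function.Injective i) {f : MvPolynomial τ K}
    {k : ℕ} (hf : f.IsHomogeneous k) : (killCompl hi f).IsHomogeneous k := by
  rw [killCompl, ← one_mul k]
  refine hf.aeval _ fun a => ?_
  split_ifs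
  · exact isHomogeneous_X K _
  · exact isHomogeneous_zero σ K 1

theorem sum_smul_eq_zero_iff {A : Type*} {w : A → ℝ} (hw : ∀ a, 0 ≤ w a) (c : A →₀ ℕ) :
    (c.sum fun a m => m • w a) = 0 ↔ ∀ a ∈ c.support, w a = 0 := by
  rw [Finsupp.sum, Finset.sum_eq_zero_iff_of_nonneg fun a _ => nsmul_nonneg (hw a) _]
  refine forall₂_congr fun a ha => ?_
  rw [smul_eq_zero, or_iff_right (Finsupp.mem_support_iff.mp ha)]

theorem support_eq_zero_congr {A : Set (ι →₀ ℕ)} {ℓ : (ι → ℝ) →ᵃ[ℝ] ℝ}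
    (hℓ : ∀ a : A, 0 ≤ ℓ (realPoint a.1)) {c c' : A →₀ ℕ}
    (h : toricExponent A c = toricExponent A c') :
    (∀ a ∈ c.support, ℓ (realPoint a.1) = 0) ↔ ∀ a ∈ c'.support, ℓ (realPoint a.1) = 0 := by
  rw [← sum_smul_eq_zero_iff hℓ, sum_smul_affineMap_congr h, sum_smul_eq_zero_iff hℓ]

theorem toricExponent_mapDomain_inclusion {A B : Set (ι →₀ ℕ)} (hAB : A ⊆ B) (c : A →₀ ℕ) :
    toricExponent B (c.mapDomain (Set.inclusion hAB)) = toricExponent A c :=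
  Finsupp.linearCombination_mapDomain ℕ _ c

theorem toricIdeal_le_comap_rename_inclusion {P Q : Set (ι → ℝ)}
    (hPQ : latticePoints P ⊆ latticePoints Q) :
    toricIdeal K P ≤ (toricIdeal K Q).comap (rename (Set.inclusion hPQ)) :=
  toricIdeal_le_comap_rename (F := AffineMap.id ℝ _) fun _ => rfl

theorem toricIdeal_le_comap_killCompl {P Q : Set (ι → ℝ)}
    (hPQ : latticePoints P ⊆ latticePoints Q)
    (hsupp : ∀ c c', toricExponent (latticePoints Q) c = toricExponent (latticePoints Q) c' →
      ((c.support : Set (latticePoints Q)) ⊆ Set.range (Set.inclusion hPQ) ↔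
        (c'.support : Set (latticePoints Q)) ⊆ Set.range (Set.inclusion hPQ))) :
    toricIdeal K Q ≤ (toricIdeal K P).comap (killCompl (Set.inclusion_injective hPQ)) := by
  have hinj := Set.inclusion_injective hPQ
  rw [toricIdeal_eq_span, Ideal.span_le]
  rintro _ ⟨c, c', h, rfl⟩
  rw [SetLike.mem_coe, Ideal.mem_comap, map_sub]
  by_cases hc : (c.support : Set (latticePoints Q)) ⊆ Set.range (Set.inclusion hPQ)
  · have hc' := (hsupp c c' h).mp hc
    rw [killCompl_monomial_eq_monomial_comapDomain_of_subset _ _ hc,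
      killCompl_monomial_eq_monomial_comapDomain_of_subset _ _ hc']
    refine toricBinomials_subset_toricIdeal P ⟨_, _, ?_, rfl⟩
    rw [← toricExponent_mapDomain_inclusion hPQ, ← toricExponent_mapDomain_inclusion hPQ,
      Finsupp.mapDomain_comapDomain _ hinj _ hc, Finsupp.mapDomain_comapDomain _ hinj _ hc', h]
  · rw [killCompl_monomial_eq_zero_of_not_subset _ _ hc,
      killCompl_monomial_eq_zero_of_not_subset _ _ (mt (hsupp c c' h).mpr hc), sub_zero]
    exact zero_mem _

theorem omega_toricIdeal_le_of_face {P Q : Set (ι → ℝ)} (hfin : (latticeVectors Q).Finite)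
    {ℓ : V → (ι → ℝ) →ᵃ[ℝ] ℝ} (hℓ : ∀ x ∈ latticeVectors Q, ∀ v, 0 ≤ ℓ v x)
    (hP : latticeVectors P = {x ∈ latticeVectors Q | ∀ v, ℓ v x = 0}) :
    omega (toricIdeal K P) ≤ omega (toricIdeal K Q) := by
  have := finite_latticePoints hfin
  have hmem (a : ι →₀ ℕ) :
      a ∈ latticePoints P ↔ a ∈ latticePoints Q ∧ ∀ v, ℓ v (realPoint a) = 0 := by
    simpa only [latticeVectors, realPoint_injective.mem_set_image, Set.mem_ofPred_eq]
      using Set.ext_iff.mp hP (realPoint a)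
  have hPQ : latticePoints P ⊆ latticePoints Q := fun a ha => ((hmem a).mp ha).1
  have hsupp (c : latticePoints Q →₀ ℕ) :
      (c.support : Set (latticePoints Q)) ⊆ Set.range (Set.inclusion hPQ) ↔
        ∀ v, ∀ a ∈ c.support, ℓ v (realPoint a.1) = 0 := by
    rw [Set.range_inclusion, forall_comm]
    exact forall_congr' fun a => ⟨fun h v ha => ((hmem a).mp (h ha)).2 v,
      fun h ha => (hmem a).mpr ⟨a.2, fun v => h v ha⟩⟩
  refine omega_toricIdeal_le_of_retract (killCompl_comp_rename (Set.inclusion_injective hPQ))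
    (fun _ _ => isHomogeneous_killCompl _) (toricIdeal_le_comap_rename_inclusion hPQ)
    (toricIdeal_le_comap_killCompl hPQ fun c c' h => ?_)
  rw [hsupp, hsupp]
  exact forall_congr' fun v =>
    support_eq_zero_congr (fun a => hℓ _ (realPoint_mem_latticeVectors a) v) h

end Face

section ZeroOne

variable {ι : Type*} {S : Set (ι → ℝ)}

theorem convexHull_subset_pi_Icc (hS : S ⊆ Set.univ.pi fun _ => {0, 1}) :
    convexHull ℝ S ⊆ Set.univ.pi fun _ => Set.Icc 0 1 := by
  refine convexHull_min (hS.trans (Set.pi_mono fun i _ => ?_)) (convex_pi fun i _ => convex_Icc 0 1)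
  exact Set.insert_subset unitInterval.zero_mem (Set.singleton_subset_iff.mpr unitInterval.one_mem)

theorem convexHull_inter_zero_one (hS : S ⊆ Set.univ.pi fun _ => {0, 1}) :
    convexHull ℝ S ∩ Set.univ.pi (fun _ => {0, 1}) = S := by
  refine subset_antisymm ?_ (Set.subset_inter (subset_convexHull ℝ S) hS)
  have hext : Set.extremePoints ℝ (Set.univ.pi fun _ : ι => Set.Icc (0 : ℝ) 1) =
      Set.univ.pi fun _ => {0, 1} := by
    simp only [extremePoints_pi, Set.extremePoints_Icc zero_le_one]
  rw [← hext]
  exact (inter_extremePoints_subset_extremePoints_of_subset (convexHull_subset_pi_Icc hS)).trans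
    extremePoints_convexHull_subset

theorem latticeVectors_convexHull [Finite ι] (hS : S ⊆ Set.univ.pi fun _ => {0, 1}) :
    latticeVectors (convexHull ℝ S) = S := by
  ext x
  constructor
  · rintro ⟨a, ha, rfl⟩
    refine convexHull_inter_zero_one hS ▸ ⟨ha, fun i _ => ?_⟩
    have hle : (a i : ℝ) ≤ 1 := (convexHull_subset_pi_Icc hS ha i trivial).2
    have h01 : a i = 0 ∨ a i = 1 := Nat.le_one_iff_eq_zero_or_eq_one.mp (by exact_mod_cast hle)
    exact h01.imp (fun h => by simp [realPoint, h]) fun h => by simp [realPoint, h]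
  · intro hx
    have hcast : ∀ i, ∃ m : ℕ, (m : ℝ) = x i := fun i =>
      (hS hx i trivial).elim (fun h => ⟨0, by simp [h]⟩) fun h => ⟨1, by simp_all⟩
    choose m hm using hcast
    have hmx : realPoint (Finsupp.equivFunOnFinite.symm m) = x := funext hm
    rw [← hmx] at hx ⊢
    exact Set.mem_image_of_mem realPoint (subset_convexHull ℝ S hx)

end ZeroOne

section Matching

variable {V W : Type*} {G : SimpleGraph V} {H : SimpleGraph W}

theorem rho_apply_of_mem {M : Set G.edgeSet} {e : G.edgeSet} (he : e ∈ M) : rho G M e = 1 :=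
  Set.indicator_of_mem he 1

theorem rho_apply_of_notMem {M : Set G.edgeSet} {e : G.edgeSet} (he : e ∉ M) : rho G M e = 0 :=
  Set.indicator_of_notMem he 1

theorem rho_mem_zero_one (M : Set G.edgeSet) : rho G M ∈ Set.univ.pi fun _ => ({0, 1} : Set ℝ) :=
  fun e _ => (em (e ∈ M)).symm.imp rho_apply_of_notMem rho_apply_of_mem

theorem rho_comp (φ : H.edgeSet → G.edgeSet) (M : Set G.edgeSet) :
    rho G M ∘ φ = rho H (φ ⁻¹' M) :=
  funext fun _ => (Set.indicator_comp_right φ (g := 1)).symm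

theorem latticeVectors_matchingPolytope [Finite G.edgeSet] :
    latticeVectors (matchingPolytope G) = {x | ∃ M, IsMatching G M ∧ x = rho G M} :=
  latticeVectors_convexHull (by rintro _ ⟨M, -, rfl⟩; exact rho_mem_zero_one M)

theorem latticeVectors_perfectMatchingPolytope [Finite G.edgeSet] :
    latticeVectors (perfectMatchingPolytope G) = {x | ∃ M, IsPerfectMatching G M ∧ x = rho G M} :=
  latticeVectors_convexHull (by rintro _ ⟨M, -, rfl⟩; exact rho_mem_zero_one M)

theorem finite_latticeVectors_matchingPolytope [Finite G.edgeSet] :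
    (latticeVectors (matchingPolytope G)).Finite := by
  rw [latticeVectors_matchingPolytope]
  exact (Set.finite_range (rho G)).subset (by rintro _ ⟨M, -, rfl⟩; exact ⟨M, rfl⟩)

theorem finite_latticeVectors_perfectMatchingPolytope [Finite G.edgeSet] :
    (latticeVectors (perfectMatchingPolytope G)).Finite := by
  rw [latticeVectors_perfectMatchingPolytope]
  exact (Set.finite_range (rho G)).subset (by rintro _ ⟨M, -, rfl⟩; exact ⟨M, rfl⟩)

theorem IsMatching.eq_of_mem {M : Set G.edgeSet} (hM : IsMatching G M) {e e' : G.edgeSet}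
    (he : e ∈ M) (he' : e' ∈ M) {v : V} (hve : v ∈ e.1) (hve' : v ∈ e'.1) : e = e' :=
  by_contra fun hne => hM e he e' he' hne v ⟨hve, hve'⟩

/-- The finite set of edges containing the vertex `v`, as elements of the type of edges of `G`. -/
noncomputable def edgesAt (G : SimpleGraph V) [Finite G.edgeSet] (v : V) : Finset G.edgeSet :=
  (Set.toFinite {e : G.edgeSet | v ∈ e.1}).toFinset

theorem mem_edgesAt [Finite G.edgeSet] {v : V} {e : G.edgeSet} : e ∈ edgesAt G v ↔ v ∈ e.1 :=
  Set.Finite.mem_toFinset _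

/-- The slack `1 - ∑ x_e` of the degree inequality of the matching polytope at the vertex `v`. -/
noncomputable def slack (G : SimpleGraph V) [Finite G.edgeSet] (v : V) :
    (G.edgeSet → ℝ) →ᵃ[ℝ] ℝ :=
  AffineMap.const ℝ _ 1 - (∑ e ∈ edgesAt G v, LinearMap.proj e).toAffineMap

theorem slack_apply [Finite G.edgeSet] (v : V) (x : G.edgeSet → ℝ) :
    slack G v x = 1 - ∑ e ∈ edgesAt G v, x e := by
  simp [slack]

theorem slack_rho_of_mem [Finite G.edgeSet] {M : Set G.edgeSet} (hM : IsMatching G M)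
    {e : G.edgeSet} (he : e ∈ M) {v : V} (hv : v ∈ e.1) : slack G v (rho G M) = 0 := by
  rw [slack_apply, Finset.sum_eq_single_of_mem e (mem_edgesAt.mpr hv), rho_apply_of_mem he,
    sub_self]
  exact fun e' hve' hne =>
    rho_apply_of_notMem fun he' => hne (hM.eq_of_mem he' he (mem_edgesAt.mp hve') hv)

theorem slack_rho_of_forall_notMem [Finite G.edgeSet] {M : Set G.edgeSet} {v : V}
    (hv : ∀ e ∈ M, v ∉ e.1) : slack G v (rho G M) = 1 := by
  rw [slack_apply, Finset.sum_eq_zero, sub_zero]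
  exact fun e he => rho_apply_of_notMem fun heM => hv e heM (mem_edgesAt.mp he)

theorem slack_rho_nonneg [Finite G.edgeSet] {M : Set G.edgeSet} (hM : IsMatching G M) (v : V) :
    0 ≤ slack G v (rho G M) := by
  by_cases hv : ∃ e ∈ M, v ∈ e.1
  · obtain ⟨e, he, hve⟩ := hv
    exact (slack_rho_of_mem hM he hve).ge
  · push Not at hv
    exact (slack_rho_of_forall_notMem hv).symm ▸ zero_le_one

theorem isPerfectMatching_iff_slack_eq_zero [Finite G.edgeSet] {M : Set G.edgeSet}
    (hM : IsMatching G M) : IsPerfectMatching G M ↔ ∀ v, slack G v (rho G M) = 0 := by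
  constructor
  · intro hP v
    obtain ⟨e, he, hv⟩ := hP.2 v
    exact slack_rho_of_mem hM he hv
  · refine fun h => ⟨hM, fun v => ?_⟩
    by_contra! hv
    exact one_ne_zero ((slack_rho_of_forall_notMem hv).symm.trans (h v))

theorem latticeVectors_perfectMatchingPolytope_eq_face [Finite G.edgeSet] :
    latticeVectors (perfectMatchingPolytope G) =
      {x ∈ latticeVectors (matchingPolytope G) | ∀ v, slack G v x = 0} := by
  rw [latticeVectors_perfectMatchingPolytope, latticeVectors_matchingPolytope]
  ext x
  constructor
  · rintro ⟨M, hM, rfl⟩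
    exact ⟨⟨M, hM.1, rfl⟩, (isPerfectMatching_iff_slack_eq_zero hM.1).mp hM⟩
  · rintro ⟨⟨M, hM, rfl⟩, h⟩
    exact ⟨M, (isPerfectMatching_iff_slack_eq_zero hM).mpr h, rfl⟩

theorem omega_perfectMatchingPolytope_le (K : Type*) [Field K] (G : SimpleGraph V)
    [Finite G.edgeSet] :
    omega (toricIdeal K (perfectMatchingPolytope G)) ≤
      omega (toricIdeal K (matchingPolytope G)) := by
  refine omega_toricIdeal_le_of_face finite_latticeVectors_matchingPolytope (fun x hx v => ?_)
    latticeVectors_perfectMatchingPolytope_eq_face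
  rw [latticeVectors_matchingPolytope] at hx
  obtain ⟨M, hM, rfl⟩ := hx
  exact slack_rho_nonneg hM v

end Matching

section Iso

variable {V W K : Type*} {G : SimpleGraph V} {H : SimpleGraph W} [Field K]

theorem IsMatching.preimage {M : Set G.edgeSet} (hM : IsMatching G M) (φ : H ↪g G) :
    IsMatching H (φ.mapEdgeSet ⁻¹' M) := fun _ he _ he' hne v hv =>
  hM _ he _ he' (φ.mapEdgeSet.injective.ne hne) (φ v)
    ⟨Sym2.mem_map.mpr ⟨v, hv.1, rfl⟩, Sym2.mem_map.mpr ⟨v, hv.2, rfl⟩⟩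

theorem IsPerfectMatching.preimage {M : Set G.edgeSet} (hM : IsPerfectMatching G M)
    (φ : H ≃g G) : IsPerfectMatching H (φ.mapEdgeSet ⁻¹' M) := by
  refine ⟨hM.1.preimage φ.toEmbedding, fun v => ?_⟩
  obtain ⟨e, he, hv⟩ := hM.2 (φ v)
  obtain ⟨e, rfl⟩ := φ.mapEdgeSet.surjective e
  obtain ⟨w, hw, hwv⟩ := Sym2.mem_map.mp hv
  exact ⟨e, he, φ.injective hwv ▸ hw⟩

theorem mapsTo_funLeft_perfectMatchingPolytope [Finite G.edgeSet] [Finite H.edgeSet]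
    (φ : H ≃g G) :
    Set.MapsTo (LinearMap.funLeft ℝ ℝ φ.mapEdgeSet).toAffineMap
      (latticeVectors (perfectMatchingPolytope G))
      (latticeVectors (perfectMatchingPolytope H)) := by
  rw [latticeVectors_perfectMatchingPolytope, latticeVectors_perfectMatchingPolytope]
  rintro _ ⟨M, hM, rfl⟩
  exact ⟨_, hM.preimage φ, rho_comp _ M⟩

theorem omega_perfectMatchingPolytope_le_of_iso [Finite G.edgeSet] (φ : G ≃g H) :
    omega (toricIdeal K (perfectMatchingPolytope G)) ≤
      omega (toricIdeal K (perfectMatchingPolytope H)) := by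
  have : Finite H.edgeSet := .of_equiv _ φ.mapEdgeSet
  refine omega_toricIdeal_le_of_affine_retract finite_latticeVectors_perfectMatchingPolytope
    (mapsTo_funLeft_perfectMatchingPolytope φ.symm) (mapsTo_funLeft_perfectMatchingPolytope φ)
    fun x _ => funext fun e => ?_
  exact congrArg x (φ.mapEdgeSet.symm_apply_apply e)

theorem omega_perfectMatchingPolytope_eq_of_iso [Finite G.edgeSet] (φ : G ≃g H) :
    omega (toricIdeal K (perfectMatchingPolytope G)) =
      omega (toricIdeal K (perfectMatchingPolytope H)) :=
  have : Finite H.edgeSet := .of_equiv _ φ.mapEdgeSet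
  (omega_perfectMatchingPolytope_le_of_iso φ).antisymm
    (omega_perfectMatchingPolytope_le_of_iso φ.symm)

end Iso

section Prism

variable {V : Type*}

/-- The prism over `G`: two copies of `G`, with an edge between each vertex and its copy. -/
def prism (G : SimpleGraph V) : SimpleGraph (Fin 2 × V) := (⊤ : SimpleGraph (Fin 2)) □ G

variable {G : SimpleGraph V}

/-- The edge of the prism corresponding to `e` in the `i`-th copy of `G`. -/
def copyEdge (G : SimpleGraph V) (i : Fin 2) : G.edgeSet ↪ (prism G).edgeSet :=
  (SimpleGraph.boxProdRight (⊤ : SimpleGraph (Fin 2)) G i).mapEdgeSet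

/-- The edge of the prism between the two copies of the vertex `v`. -/
def rung (G : SimpleGraph V) (v : V) : (prism G).edgeSet :=
  ⟨s((0, v), (1, v)), by simp [prism]⟩

/-- The edges of the prism: two for each edge of `G` and one for each vertex. -/
def prismEdge (G : SimpleGraph V) : (Fin 2 × G.edgeSet) ⊕ V → (prism G).edgeSet :=
  Sum.elim (fun p => copyEdge G p.1 p.2) (rung G)

theorem mem_copyEdge {i j : Fin 2} {e : G.edgeSet} {v : V} :
    (j, v) ∈ (copyEdge G i e).1 ↔ j = i ∧ v ∈ e.1 := by
  refine Sym2.mem_map.trans ⟨?_, ?_⟩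
  · rintro ⟨w, hw, h⟩
    obtain ⟨rfl, rfl⟩ := Prod.mk.inj h
    exact ⟨rfl, hw⟩
  · rintro ⟨rfl, hv⟩
    exact ⟨v, hv, rfl⟩

theorem mem_rung {i : Fin 2} {v w : V} : (i, w) ∈ (rung G v).1 ↔ w = v := by
  fin_cases i <;> simp [rung]

theorem copyEdge_ne_rung (i : Fin 2) (e : G.edgeSet) (v : V) : copyEdge G i e ≠ rung G v := by
  intro h
  have hmem (j : Fin 2) : j = i := (mem_copyEdge.mp (h ▸ mem_rung.mpr rfl : (j, v) ∈ _)).1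
  exact zero_ne_one ((hmem 0).trans (hmem 1).symm)

theorem copyEdge_inj {i j : Fin 2} {e e' : G.edgeSet} :
    copyEdge G i e = copyEdge G j e' ↔ i = j ∧ e = e' := by
  refine ⟨fun h => ?_, by rintro ⟨rfl, rfl⟩; rfl⟩
  have hmem : (i, e.1.out.1) ∈ (copyEdge G i e).1 := mem_copyEdge.mpr ⟨rfl, e.1.out_fst_mem⟩
  rw [h] at hmem
  obtain rfl := (mem_copyEdge.mp hmem).1
  exact ⟨rfl, (copyEdge G i).injective h⟩

theorem rung_injective : Function.Injective (rung G) := by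
  intro v w h
  have hmem : (0, v) ∈ (rung G v).1 := mem_rung.mpr rfl
  rw [h] at hmem
  exact mem_rung.mp hmem

theorem prismEdge_injective : Function.Injective (prismEdge G) := by
  refine Function.Injective.sumElim ?_ rung_injective fun p v => copyEdge_ne_rung p.1 p.2 v
  exact fun p p' h => Prod.ext_iff.mpr (copyEdge_inj.mp h)

theorem prismEdge_surjective : Function.Surjective (prismEdge G) := by
  rintro ⟨e, he⟩
  induction e with
  | h p q =>
    obtain ⟨i, u⟩ := p
    obtain ⟨j, v⟩ := q
    obtain ⟨hij : i ≠ j, rfl : u = v⟩ | ⟨huv, rfl : i = j⟩ := SimpleGraph.boxProd_adj.mp he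
    · refine ⟨.inr u, Subtype.ext ?_⟩
      obtain ⟨rfl, rfl⟩ | ⟨rfl, rfl⟩ : i = 0 ∧ j = 1 ∨ i = 1 ∧ j = 0 := by omega
      exacts [rfl, Sym2.eq_swap]
    · exact ⟨.inl (i, ⟨s(u, v), huv⟩), rfl⟩

/-- The bijection between the edges of the prism and two copies of the edges of `G` together with
the vertices of `G`. -/
noncomputable def prismEdgeEquiv (G : SimpleGraph V) :
    (Fin 2 × G.edgeSet) ⊕ V ≃ (prism G).edgeSet :=
  .ofBijective (prismEdge G) ⟨prismEdge_injective, prismEdge_surjective⟩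

theorem ncard_edgeSet_prism [Finite V] :
    (prism G).edgeSet.ncard = 2 * G.edgeSet.ncard + Nat.card V := by
  rw [← Nat.card_coe_set_eq, ← Nat.card_congr (prismEdgeEquiv G), Nat.card_sum, Nat.card_prod,
    Nat.card_fin, Nat.card_coe_set_eq]

/-- The perfect matching of the prism that contains both copies of the edges of `M` and joins the
two copies of each vertex not covered by `M`. -/
def prismMatching (M : Set G.edgeSet) : Set (prism G).edgeSet :=
  prismEdge G '' {x | x.elim (fun p => p.2 ∈ M) fun v => ∀ e ∈ M, v ∉ e.1}

theorem copyEdge_mem_prismMatching {M : Set G.edgeSet} {i : Fin 2} {e : G.edgeSet} :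
    copyEdge G i e ∈ prismMatching M ↔ e ∈ M :=
  prismEdge_injective.mem_set_image (a := .inl (i, e))

theorem rung_mem_prismMatching {M : Set G.edgeSet} {v : V} :
    rung G v ∈ prismMatching M ↔ ∀ e ∈ M, v ∉ e.1 :=
  prismEdge_injective.mem_set_image (a := .inr v)

theorem isPerfectMatching_prismMatching {M : Set G.edgeSet} (hM : IsMatching G M) :
    IsPerfectMatching (prism G) (prismMatching M) := by
  constructor
  · rintro _ ⟨⟨i, e⟩ | v, he, rfl⟩ _ ⟨⟨j, e'⟩ | w, he', rfl⟩ hne ⟨k, u⟩ ⟨hu, hu'⟩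
    · obtain ⟨rfl, hue⟩ := mem_copyEdge.mp hu
      obtain ⟨rfl, hue'⟩ := mem_copyEdge.mp hu'
      exact hne (congrArg (copyEdge G k) (hM.eq_of_mem he he' hue hue'))
    · obtain rfl := mem_rung.mp hu'
      exact he' e he (mem_copyEdge.mp hu).2
    · obtain rfl := mem_rung.mp hu
      exact he e' he' (mem_copyEdge.mp hu').2
    · exact hne (by rw [← mem_rung.mp hu, mem_rung.mp hu'])
  · rintro ⟨i, v⟩
    by_cases hv : ∃ e ∈ M, v ∈ e.1
    · obtain ⟨e, he, hve⟩ := hv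
      exact ⟨_, copyEdge_mem_prismMatching.mpr he, mem_copyEdge.mpr ⟨rfl, hve⟩⟩
    · push Not at hv
      exact ⟨_, rung_mem_prismMatching.mpr hv, mem_rung.mpr rfl⟩

/-- The affine map sending the vector of a matching to that of the associated perfect matching of
the prism. -/
noncomputable def prismExtend (G : SimpleGraph V) [Finite G.edgeSet] :
    (G.edgeSet → ℝ) →ᵃ[ℝ] ((prism G).edgeSet → ℝ) :=
  AffineMap.pi fun e =>
    ((prismEdgeEquiv G).symm e).elim (fun p => (LinearMap.proj p.2).toAffineMap) (slack G)

theorem prismExtend_copyEdge [Finite G.edgeSet] (x : G.edgeSet → ℝ) (i : Fin 2) (e : G.edgeSet) :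
    prismExtend G x (copyEdge G i e) = x e := by
  have hsymm : (prismEdgeEquiv G).symm (copyEdge G i e) = .inl (i, e) :=
    (prismEdgeEquiv G).symm_apply_apply (.inl (i, e))
  rw [prismExtend, AffineMap.pi_apply, hsymm]
  rfl

theorem prismExtend_rung [Finite G.edgeSet] (x : G.edgeSet → ℝ) (v : V) :
    prismExtend G x (rung G v) = slack G v x := by
  have hsymm : (prismEdgeEquiv G).symm (rung G v) = .inr v :=
    (prismEdgeEquiv G).symm_apply_apply (.inr v)
  rw [prismExtend, AffineMap.pi_apply, hsymm]
  rfl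

theorem prismExtend_rho [Finite G.edgeSet] {M : Set G.edgeSet} (hM : IsMatching G M) :
    prismExtend G (rho G M) = rho (prism G) (prismMatching M) := by
  ext e
  obtain ⟨⟨i, e⟩ | v, rfl⟩ := prismEdge_surjective e
  · exact (prismExtend_copyEdge _ i e).trans
      (Set.indicator_const_eq_indicator_const copyEdge_mem_prismMatching.symm)
  · refine (prismExtend_rung _ v).trans ?_
    by_cases hv : ∃ e ∈ M, v ∈ e.1
    · obtain ⟨e, he, hve⟩ := hv
      rw [slack_rho_of_mem hM he hve]
      exact (rho_apply_of_notMem fun h => rung_mem_prismMatching.mp h e he hve).symm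
    · push Not at hv
      rw [slack_rho_of_forall_notMem hv]
      exact (rho_apply_of_mem (rung_mem_prismMatching.mpr hv)).symm

theorem mapsTo_prismExtend [Finite V] :
    Set.MapsTo (prismExtend G) (latticeVectors (matchingPolytope G))
      (latticeVectors (perfectMatchingPolytope (prism G))) := by
  rw [latticeVectors_matchingPolytope, latticeVectors_perfectMatchingPolytope]
  rintro _ ⟨M, hM, rfl⟩
  exact ⟨_, isPerfectMatching_prismMatching hM, prismExtend_rho hM⟩

theorem mapsTo_funLeft_copyEdge [Finite V] (i : Fin 2) :
    Set.MapsTo (LinearMap.funLeft ℝ ℝ (copyEdge G i)).toAffineMap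
      (latticeVectors (perfectMatchingPolytope (prism G)))
      (latticeVectors (matchingPolytope G)) := by
  rw [latticeVectors_matchingPolytope, latticeVectors_perfectMatchingPolytope]
  rintro _ ⟨N, hN, rfl⟩
  exact ⟨_, hN.1.preimage (SimpleGraph.boxProdRight _ G i), rho_comp _ N⟩

theorem omega_matchingPolytope_le_prism (K : Type*) [Field K] [Finite V] (G : SimpleGraph V) :
    omega (toricIdeal K (matchingPolytope G)) ≤
      omega (toricIdeal K (perfectMatchingPolytope (prism G))) :=
  omega_toricIdeal_le_of_affine_retract finite_latticeVectors_perfectMatchingPolytope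
    mapsTo_prismExtend (mapsTo_funLeft_copyEdge 0)
    fun x _ => funext fun e => prismExtend_copyEdge x 0 e

end Prism

/-- The isomorphism relabelling the vertex `(i, v)` of the prism as `v + i * d`. -/
noncomputable def prismIsoDoubleGraph {d : ℕ} (G : SimpleGraph (Fin d)) :
    prism G ≃g doubleGraph G :=
  SimpleGraph.Iso.map finProdFinEquiv (prism G)

end MatchingToric

open MatchingToric in
theorem proposition5_general (K : Type*) [Field K] {V : Type*} [Finite V] (G : SimpleGraph V) :
    omega (toricIdeal K (perfectMatchingPolytope G)) ≤
        omega (toricIdeal K (matchingPolytope G)) ∧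
      (prism G).edgeSet.ncard = 2 * G.edgeSet.ncard + Nat.card V ∧
      omega (toricIdeal K (matchingPolytope G)) ≤
        omega (toricIdeal K (perfectMatchingPolytope (prism G))) :=
  ⟨omega_perfectMatchingPolytope_le K G, ncard_edgeSet_prism,
    omega_matchingPolytope_le_prism K G⟩

theorem proposition5 (K : Type*) [Field K] (d n : ℕ) (G : SimpleGraph (Fin d))
    (hn : G.edgeSet.ncard = n) :
    MatchingToric.omega (MatchingToric.toricIdeal K (MatchingToric.perfectMatchingPolytope G)) ≤
        MatchingToric.omega (MatchingToric.toricIdeal K (MatchingToric.matchingPolytope G)) ∧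
      (MatchingToric.doubleGraph G).edgeSet.ncard = 2 * n + d ∧
      MatchingToric.omega (MatchingToric.toricIdeal K (MatchingToric.matchingPolytope G)) ≤
        MatchingToric.omega (MatchingToric.toricIdeal K
          (MatchingToric.perfectMatchingPolytope (MatchingToric.doubleGraph G))) := by
  obtain ⟨hperfect, hcard, hprism⟩ := proposition5_general K G
  have φ := MatchingToric.prismIsoDoubleGraph G
  refine ⟨hperfect, ?_, ?_⟩
  · rw [← Nat.card_coe_set_eq, ← Nat.card_congr φ.mapEdgeSet, Nat.card_coe_set_eq, hcard, hn,
      Nat.card_fin]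
  · rwa [← MatchingToric.omega_perfectMatchingPolytope_eq_of_iso φ]
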